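/- A MapReduce step consists of an input multiset $A$, a mapping function $\mu$ sending each input element to a multiset of key--value pairs, and a reduction function $\rho$. Let $B=\bigcup_{a\in A}\mu(a)$ be the multiset of all pairs produced, let $C$ be the set of all $(k,X)$ where $k$ is a key occurring in $B$ and $X$ is the multiset of values paired with $k$ in $B$, and let the output $D$ be the multiset of all elements emitted by the calls $\rho(k,X)$, $(k,X)\in C$ (each call emits its elements in some order). Let $w$ be the total time and $\hat w$ the maximum time of a single call over all evaluations of $\mu$ on $A$ and of $\rho$ on $C$; let $m$ be the total number of machine words in $A,B,C,D$ and $\hat m$ the maximum number of machine words consumed or produced by a single such call, where the size of $(k,X)\in C$ is the total size of the key--value pairs collected in it. A multiset is \emph{randomly distributed} over $p$ processing elements (PEs) if each of its elements is placed on a PE chosen independently and uniformly at random. A BSP superstep takes time $W+L+gH$, where $W$ is the maximum local work and $H$ the maximum number of machine words sent and received by any PE. Consider the following implementation with two supersteps. In the first, every PE applies $\mu$ to its local elements of $A$ and sends each resulting pair $(k,v)$ to PE $h(k)$, where $h$ is a hash function into $\{1,\dots,p\}$. In the second, every PE groups the received pairs by key and applies $\rho$ to each group; the first element emitted by a call of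 $\rho$ stays on its PE and every further one is sent to its own random PE. Besides the evaluations of $\mu$ and $\rho$, the local work includes $\kappa$ time units of bookkeeping per machine word that a PE reads, produces or assembles (operations on the local hash table cost constant time per word). **Theorem.** Let $p\ge 1$ and $L\ge 0$, let $\kappa\ge 0$ and $g_0>0$ be constants and $g\ge g_0$. Assume that $A$ is randomly distributed over the PEs and that the hash function is truly random, i.e. the values $h(k)$ and the random destinations of output elements are independent and uniform. Then the expected running time of the two supersteps is $$O\Bigl(\hat w\,\hat o\bigl(\tfrac{w}{\hat w},p\bigr)+L+g\,\hat m\,\hat o\bigl(\tfrac{m}{\hat m},p\bigr)\Bigr),$$ where $\hat o(b,p)$ is the expected maximum number of balls in a bin when $\lceil b\rceil$ balls are placed into $p$ bins independently and uniformly at random (a term with $\hat w=0$ or $\hat m=0$ is $0$); the implied constant depends only on $\kappa$ and $g_0$. In particular, for every $c>0$, if $w\ge c\,\hat w\,p\log p$ and $m\ge c\,\hat m\,p\log p$, then the expected running time is $O\bigl(\frac wp+L+g\frac mp\bigr)$, with a constant depending only on $\kappa$, $g_0$ and $c$. Moreover, the implementation outputs $D$, and $D$ is randomly distributed over the PEs.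 -/

import Mathlib

open scoped NNReal ENNReal

/-- A MapReduce step with its cost measures.  Input elements have type `I`, keys `K`, values `V`,
output elements `O`.  The user-defined functions are `map` (written μ in the literature) and
`reduce` (written ρ); `reduce` lists its output elements in the order in which it emits them.
The evaluation times and the sizes in machine words are arbitrary nonnegative cost functions. -/
structure MapReduce (I K V O : Type*) where
  map : I → Multiset (K × V)
  reduce : K → Multiset V → List O
  mapTime : I → ℝ≥0
  reduceTime : K → Multiset V → ℝ≥0
  inputWords : I → ℕ
  pairWords : K × V → ℕ
  outputWords : O → ℕ

namespace MapReduce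

variable {I K V O : Type*} [DecidableEq K]

/-- The keys that occur in a multiset of key-value pairs. -/
def keys (B : Multiset (K × V)) : Finset K := (B.map Prod.fst).toFinset

/-- The multiset of all values that are paired with the key `k`. -/
def valuesOf (B : Multiset (K × V)) (k : K) : Multiset V :=
  (B.filter fun b => b.1 = k).map Prod.snd

variable (M : MapReduce I K V O)

/-- The multiset `B` of key-value pairs produced by mapping all elements of the input `A`. -/
def pairs (A : Multiset I) : Multiset (K × V) := A.bind M.map

/-- The output multiset `D`: the reduction function applied to every `(k, X)` in `C`. -/
def output (A : Multiset I) : Multiset O :=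
  ∑ k ∈ keys (M.pairs A), (M.reduce k (valuesOf (M.pairs A) k) : Multiset O)

/-- Words of a multiset of input elements. -/
def wordsI (A : Multiset I) : ℕ := (A.map M.inputWords).sum

/-- Words of a multiset of key-value pairs. -/
def wordsB (B : Multiset (K × V)) : ℕ := (B.map M.pairWords).sum

/-- Words of the element `(k, X)` of `C`: those of the key-value pairs collected in it. -/
def wordsC (k : K) (X : Multiset V) : ℕ := (X.map fun x => M.pairWords (k, x)).sum

/-- Words of a multiset of output elements. -/
def wordsD (D : Multiset O) : ℕ := (D.map M.outputWords).sum

/-- `w`: the total time of all evaluations of `map` and `reduce`. -/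
def totalWork (A : Multiset I) : ℝ≥0 :=
  (A.map M.mapTime).sum
    + ∑ k ∈ keys (M.pairs A), M.reduceTime k (valuesOf (M.pairs A) k)

/-- `ŵ`: the maximum time of a single evaluation of `map` or `reduce`. -/
def maxWork (A : Multiset I) : ℝ≥0 :=
  (A.map M.mapTime).sup
    ⊔ (keys (M.pairs A)).sup fun k => M.reduceTime k (valuesOf (M.pairs A) k)

/-- `m`: the total number of machine words in the sets `A`, `B`, `C`, `D`. -/
def totalWords (A : Multiset I) : ℕ :=
  M.wordsI A + M.wordsB (M.pairs A)
    + (∑ k ∈ keys (M.pairs A), M.wordsC k (valuesOf (M.pairs A) k))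
    + M.wordsD (M.output A)

/-- `m̂`: the maximum number of machine words consumed or produced by a single evaluation of
`map` or `reduce`. -/
def maxWords (A : Multiset I) : ℕ :=
  (A.map fun a => M.inputWords a ⊔ M.wordsB (M.map a)).sup
    ⊔ (keys (M.pairs A)).sup fun k =>
        M.wordsC k (valuesOf (M.pairs A) k)
          ⊔ M.wordsD (M.reduce k (valuesOf (M.pairs A) k) : Multiset O)

end MapReduce

/-- The parameters of the BSP machine: latency `L`, gap `g`, and the local work `κ` per machine
word for bookkeeping (reading local data, hashing keys, operating on the local hash table,
writing results). -/
structure BSPMachine where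
  L : ℝ≥0
  g : ℝ≥0
  κ : ℝ≥0

/-- The time of one BSP superstep: `work i` is the local work of PE `i`, and `vol i` the number of
machine words that PE `i` sends and receives. -/
def BSPMachine.superstepTime (S : BSPMachine) {p : ℕ} (work : Fin p → ℝ≥0) (vol : Fin p → ℕ) :
    ℝ≥0 :=
  Finset.univ.sup work + S.L + S.g * (Finset.univ.sup vol : ℕ)

namespace MapReduce

/-! The BSP implementation for one outcome of the random choices: `store i` holds the input
elements on PE `i`, `h` is the hash function, and the `t`-th element emitted by the call of
`reduce` on key `k` (counting from `0`) is sent to PE `r (k, t)` if `t ≠ 0`. The first element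
emitted by a call stays where it is.  A PE uses only data that is stored at it or has been sent to
it.  Data that a PE sends to itself is counted as communicated, too. -/

section BSP

variable {I K V O : Type*} [DecidableEq K] (M : MapReduce I K V O) {p : ℕ}
  (store : Fin p → Multiset I) (h : K → Fin p) (r : K × ℕ → Fin p)

/-- First superstep: the key-value pairs that PE `i` produces and sends to PE `j`. -/
def sentPairs (i j : Fin p) : Multiset (K × V) :=
  (M.pairs (store i)).filter fun b => h b.1 = j

/-- The key-value pairs that PE `j` has received by the end of the first superstep. -/
def receivedPairs (j : Fin p) : Multiset (K × V) := ∑ i, M.sentPairs store h i j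

/-- Local work of PE `i` in the first superstep: evaluating `map` on the local elements, and
bookkeeping for the elements consumed and the pairs produced. -/
def work₁ (S : BSPMachine) (i : Fin p) : ℝ≥0 :=
  ((store i).map M.mapTime).sum
    + S.κ * (M.wordsI (store i) + M.wordsB (M.pairs (store i)) : ℕ)

/-- Words sent and received by PE `i` in the first superstep. -/
def volume₁ (i : Fin p) : ℕ :=
  (∑ j, M.wordsB (M.sentPairs store h i j)) + ∑ j, M.wordsB (M.sentPairs store h j i)

/-- The keys for which PE `j` holds an entry after assembling the received pairs. -/
def localKeys (j : Fin p) : Finset K := keys (M.receivedPairs store h j)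

/-- The values assembled by PE `j` for the key `k`. -/
def localValues (j : Fin p) (k : K) : Multiset V := valuesOf (M.receivedPairs store h j) k

/-- The output elements emitted, in this order, by the call of `reduce` for key `k` on PE `j`. -/
def emitted (j : Fin p) (k : K) : List O := M.reduce k (M.localValues store h j k)

/-- The output elements that PE `j` keeps: the first one emitted by each of its calls. -/
def keptOutput (j : Fin p) : Multiset O :=
  ∑ k ∈ M.localKeys store h j, ((M.emitted store h j k).take 1 : Multiset O)

/-- Second superstep: the output elements that PE `j` sends to PE `l`. -/
def sentOutput (j l : Fin p) : Multiset O :=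
  ∑ k ∈ M.localKeys store h j,
    (Finset.univ.filter fun t : Fin (M.emitted store h j k).length =>
      (t : ℕ) ≠ 0 ∧ r (k, t) = l).val.map (M.emitted store h j k).get

/-- Local work of PE `j` in the second superstep: evaluating `reduce` on the assembled elements
of `C`, and bookkeeping for the pairs received and the output elements produced. -/
def work₂ (S : BSPMachine) (j : Fin p) : ℝ≥0 :=
  (∑ k ∈ M.localKeys store h j, M.reduceTime k (M.localValues store h j k))
    + S.κ * (M.wordsB (M.receivedPairs store h j)
        + ∑ k ∈ M.localKeys store h j, M.wordsD (M.emitted store h j k : Multiset O) : ℕ)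

/-- Words sent and received by PE `j` in the second superstep. -/
def volume₂ (j : Fin p) : ℕ :=
  (∑ l, M.wordsD (M.sentOutput store h r j l)) + ∑ l, M.wordsD (M.sentOutput store h r l j)

/-- The running time of the two supersteps. -/
def bspTime (S : BSPMachine) : ℝ≥0 :=
  S.superstepTime (M.work₁ store S) (M.volume₁ store h)
    + S.superstepTime (M.work₂ store h S) (M.volume₂ store h r)

/-- The output elements stored at PE `l` when the implementation ends. -/
def bspOutput (l : Fin p) : Multiset O :=
  M.keptOutput store h l + ∑ j, M.sentOutput store h r j l

end BSP

end MapReduce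

section Randomness

variable {Ω : Type*} [MeasurableSpace Ω] {p : ℕ}

/-- The random PE numbers `X i` are independent and uniformly distributed. -/
def IsTrulyRandom {ι : Type*} (P : MeasureTheory.Measure Ω) (X : ι → Ω → Fin p) : Prop :=
  (∀ i, Measurable (X i)) ∧ ProbabilityTheory.iIndepFun X P ∧
    ∀ i j, P (X i ⁻¹' {j}) = (p : ℝ≥0∞)⁻¹

/-- The multiset `A` is randomly distributed over the PEs, PE `j` storing `store ω j`: every
element of `A` (counted with multiplicity) is stored on a PE that is chosen independently and
uniformly at random. -/
def IsRandomlyDistributed {α : Type*} (P : MeasureTheory.Measure Ω) (A : Multiset α)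
    (store : Ω → Fin p → Multiset α) : Prop :=
  ∃ (n : ℕ) (a : Fin n → α) (X : Fin n → Ω → Fin p),
    Finset.univ.val.map a = A ∧ IsTrulyRandom P X ∧
      ∀ ω j, store ω j = (Finset.univ.filter fun i => X i ω = j).val.map a

end Randomness

/-- `ô(b, p)`: the expected maximum occupancy of a bin when `⌈b⌉` balls are placed into `p` bins
independently and uniformly at random, i.e. the average over all placements. -/
noncomputable def expMaxOccupancy (b : ℝ≥0) (p : ℕ) : ℝ :=
  (∑ f : Fin ⌈b⌉₊ → Fin p,
    ((Finset.univ.sup fun j : Fin p => (Finset.univ.filter fun i => f i = j).card : ℕ) : ℝ))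
      / (p : ℝ) ^ ⌈b⌉₊

/-! Everything a PE computes, sends or receives is a load: a sum of ball weights over the balls
placed in its bin. There are three random placements: the input elements, the occurring keys (placed
by the hash function), and the emissions of `reduce` (placed by `r`). `bspTime_eq_loadTime` rewrites
the running time in this form. By linearity of expectation it then suffices to bound one expected
maximum load at a time.

The key estimate is `Placement.meanMaxLoad_le`: balls of weight at most B and total weight at most T
have expected maximum load at most B·ô(T/B, p). After scaling to B = 1, the expected maximum load is
a convex function of the weight vector, invariant under permuting balls. Hence making two weights
more unequal at constant sum never decreases it (`meanMaxLoad_le_of_transfer`). Repeating this until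
at most one weight lies strictly between 0 and 1 leaves at most ⌈T/B⌉ balls, and rounding up the
last fractional weight gives unit balls.

With B and T equal to ŵ and w, or m̂ and m, this yields the first bound; κ is absorbed into g
through g ≥ g₀. For the corollary, the exponential moment bound `expMaxOccupancy_le` gives ô(b, p) ≤
log p + 2⌈b⌉/p. The output is randomly distributed because distinct emissions take their
destinations from distinct independent random values (`injective_emission_source`). -/

namespace Placement

open Finset

/-! ### Loads of weighted balls in bins, and their maximum. -/

section Load

variable {ι κ R : Type*} [Fintype ι] [Fintype κ] [AddCommMonoid R] {p : ℕ}

/-- The total weight of the balls that the placement `f` puts into bin `j`. -/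
def load (x : ι → R) (f : ι → Fin p) (j : Fin p) : R := ∑ i with f i = j, x i

theorem load_comp_embedding (e : κ ↪ ι) (x : ι → R) (hx : ∀ i ∉ Set.range e, x i = 0)
    (f : ι → Fin p) (j : Fin p) : load (x ∘ e) (f ∘ e) j = load x f j := by
  simp only [load, sum_filter, Function.comp_apply]
  rw [← sum_map univ e fun i => if f i = j then x i else 0]
  refine sum_subset (subset_univ _) fun i _ hi => ?_
  rw [hx i (by simpa using hi), ite_self]

theorem load_comp_equiv (e : κ ≃ ι) (x : ι → R) (f : ι → Fin p) (j : Fin p) :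
    load (x ∘ e) (f ∘ e) j = load x f j :=
  load_comp_embedding e.toEmbedding x (fun i hi => (hi ⟨e.symm i, by simp⟩).elim) f j

theorem natCast_load (x : ι → ℕ) (f : ι → Fin p) (j : Fin p) :
    ((load x f j : ℕ) : ℝ≥0) = load (fun i => (x i : ℝ≥0)) f j :=
  Nat.cast_sum _ _

theorem load_add (x y : ι → R) (f : ι → Fin p) (j : Fin p) :
    load (fun i => x i + y i) f j = load x f j + load y f j :=
  sum_add_distrib

theorem sum_load (x : ι → R) (f : ι → Fin p) : ∑ j, load x f j = ∑ i, x i :=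
  sum_fiberwise _ _ _

end Load

section MaxLoad

variable {ι κ : Type*} [Fintype ι] [Fintype κ] {p : ℕ}

/-- The maximum weight of a bin under the placement `f`. -/
def maxLoad (x : ι → ℝ≥0) (f : ι → Fin p) : ℝ≥0 := univ.sup (load x f)

theorem load_le_maxLoad (x : ι → ℝ≥0) (f : ι → Fin p) (j : Fin p) : load x f j ≤ maxLoad x f :=
  le_sup (f := load x f) (mem_univ j)

theorem maxLoad_mono {x y : ι → ℝ≥0} (hxy : ∀ i, x i ≤ y i) (f : ι → Fin p) :
    maxLoad x f ≤ maxLoad y f :=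
  sup_mono_fun fun _ _ => sum_le_sum fun i _ => hxy i

theorem maxLoad_comp_embedding (e : κ ↪ ι) (x : ι → ℝ≥0) (hx : ∀ i ∉ Set.range e, x i = 0)
    (f : ι → Fin p) : maxLoad (x ∘ e) (f ∘ e) = maxLoad x f :=
  congrArg _ (funext fun j => load_comp_embedding e x hx f j)

theorem maxLoad_comp_embedding_le (e : κ ↪ ι) (x : ι → ℝ≥0) (f : ι → Fin p) :
    maxLoad (x ∘ e) (f ∘ e) ≤ maxLoad x f := by
  refine sup_mono_fun fun j _ => ?_
  simp only [load, sum_filter, Function.comp_apply]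
  rw [← sum_map univ e fun i => if f i = j then x i else 0]
  exact sum_le_sum_of_subset (subset_univ _)

theorem maxLoad_const_mul (c : ℝ≥0) (x : ι → ℝ≥0) (f : ι → Fin p) :
    maxLoad (fun i => c * x i) f = c * maxLoad x f := by
  simp only [maxLoad, NNReal.mul_finset_sup]
  exact congrArg _ (funext fun j => (mul_sum _ _ _).symm)

theorem maxLoad_add_le (x y : ι → ℝ≥0) (f : ι → Fin p) :
    maxLoad (fun i => x i + y i) f ≤ maxLoad x f + maxLoad y f :=
  Finset.sup_le fun j _ => by
    rw [load_add]
    exact add_le_add (load_le_maxLoad x f j) (load_le_maxLoad y f j)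

end MaxLoad

/-! ### Expected maximum load: convexity, extremal weights, exponential moments. -/

section Average

variable {ι κ : Type*} [Fintype ι] [Fintype κ] [DecidableEq ι] [DecidableEq κ] {p : ℕ}

/-- The average over all placements. -/
noncomputable def average (φ : (ι → Fin p) → ℝ) : ℝ := (∑ f, φ f) / (p : ℝ) ^ Fintype.card ι

theorem average_mono {φ ψ : (ι → Fin p) → ℝ} (hle : ∀ f, φ f ≤ ψ f) : average φ ≤ average ψ :=
  div_le_div_of_nonneg_right (sum_le_sum fun f _ => hle f) (by positivity)

theorem average_add (φ ψ : (ι → Fin p) → ℝ) :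
    average (fun f => φ f + ψ f) = average φ + average ψ := by
  simp only [average, sum_add_distrib, add_div]

theorem average_const_mul (c : ℝ) (φ : (ι → Fin p) → ℝ) :
    average (fun f => c * φ f) = c * average φ := by
  simp only [average, ← mul_sum, mul_div_assoc]

/-- Averages are preserved when further balls are added and balls are renamed. -/
theorem average_comp_embedding (hp : 0 < p) (e : κ ↪ ι) (φ : (κ → Fin p) → ℝ) :
    average (fun f : ι → Fin p => φ (f ∘ e)) = average φ := by
  classical
  -- A placement of all balls is a placement of the embedded ones together with a free placement of
  -- the others, so each value of `φ` is counted `p` to the number of other balls many times.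
  let E : κ ⊕ {i // i ∉ Set.range e} ≃ ι :=
    ((Equiv.ofInjective e e.injective).sumCongr (Equiv.refl _)).trans
      (Equiv.sumCompl fun i => i ∈ Set.range e)
  have hE : ∀ k, E (Sum.inl k) = e k := fun k => rfl
  have hcard : Fintype.card ι = Fintype.card κ + Fintype.card {i // i ∉ Set.range e} := by
    rw [← Fintype.card_congr E, Fintype.card_sum]
  have hsum : ∑ f : ι → Fin p, φ (f ∘ e)
      = ∑ g : (κ → Fin p) × ({i // i ∉ Set.range e} → Fin p), φ g.1 :=
    Fintype.sum_equiv ((E.arrowCongr (Equiv.refl _)).symm.trans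
      (Equiv.sumArrowEquivProdArrow _ _ _)) _ _ fun f => rfl
  have hp' : (p : ℝ) ≠ 0 := by positivity
  rw [average, hsum, Fintype.sum_prod_type, average, hcard, pow_add]
  simp only [sum_const, card_univ, Fintype.card_fun, Fintype.card_fin, nsmul_eq_mul,
    ← mul_sum]
  push_cast
  field_simp

/-- The expected maximum weight of a bin when balls of weights `x i` are placed into `p` bins
independently and uniformly at random. -/
noncomputable def meanMaxLoad (p : ℕ) (x : ι → ℝ≥0) : ℝ :=
  average fun f : ι → Fin p => (maxLoad x f : ℝ)

theorem meanMaxLoad_mono {x y : ι → ℝ≥0} (hxy : ∀ i, x i ≤ y i) :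
    meanMaxLoad p x ≤ meanMaxLoad p y :=
  average_mono fun f => NNReal.coe_le_coe.2 (maxLoad_mono hxy f)

theorem meanMaxLoad_comp_embedding (hp : 0 < p) (e : κ ↪ ι) (x : ι → ℝ≥0)
    (hx : ∀ i ∉ Set.range e, x i = 0) : meanMaxLoad p (x ∘ e) = meanMaxLoad p x := by
  rw [meanMaxLoad, ← average_comp_embedding hp e]
  simp only [maxLoad_comp_embedding e x hx, meanMaxLoad]

theorem meanMaxLoad_comp_embedding_le (hp : 0 < p) (e : κ ↪ ι) (x : ι → ℝ≥0) :
    meanMaxLoad p (x ∘ e) ≤ meanMaxLoad p x := by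
  rw [meanMaxLoad, ← average_comp_embedding hp e]
  exact average_mono fun f => NNReal.coe_le_coe.2 (maxLoad_comp_embedding_le e x f)

theorem meanMaxLoad_const_mul (c : ℝ≥0) (x : ι → ℝ≥0) :
    meanMaxLoad p (fun i => c * x i) = c * meanMaxLoad p x := by
  simp only [meanMaxLoad, maxLoad_const_mul, NNReal.coe_mul, average_const_mul]

theorem meanMaxLoad_add_le (x y : ι → ℝ≥0) :
    meanMaxLoad p (fun i => x i + y i) ≤ meanMaxLoad p x + meanMaxLoad p y := by
  rw [meanMaxLoad, meanMaxLoad, meanMaxLoad, ← average_add]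
  exact average_mono fun f => by exact_mod_cast maxLoad_add_le x y f

theorem expMaxOccupancy_eq_meanMaxLoad (b : ℝ≥0) (p : ℕ) :
    expMaxOccupancy b p = meanMaxLoad p (1 : Fin ⌈b⌉₊ → ℝ≥0) := by
  have hcast : ∀ v : Fin p → ℕ,
      (((univ.sup v : ℕ) : ℝ≥0) : ℝ) = ((univ.sup fun j => (v j : ℝ≥0) : ℝ≥0) : ℝ) := fun v => by
    rw [apply_sup_eq_sup_comp (fun n : ℕ => (n : ℝ≥0)) (fun a b => Nat.cast_max a b)
      Nat.cast_zero]
    rfl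
  simp only [expMaxOccupancy, meanMaxLoad, average, Fintype.card_fin, maxLoad]
  congr 1
  refine sum_congr rfl fun f _ => ?_
  rw [← NNReal.coe_natCast, hcast]
  simp only [card_eq_sum_ones, Nat.cast_sum, Nat.cast_one]
  rfl

theorem expMaxOccupancy_nonneg (b : ℝ≥0) (p : ℕ) : 0 ≤ expMaxOccupancy b p := by
  unfold expMaxOccupancy
  positivity

/-- Moving weight between two balls so that their weights become more unequal increases the
expected maximum weight of a bin. -/
theorem meanMaxLoad_le_of_transfer (hp : 0 < p) {x y : ι → ℝ≥0} {i j : ι} (hij : i ≠ j)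
    (hxy : ∀ k, k ≠ i → k ≠ j → y k = x k) (hsum : y i + y j = x i + x j)
    (hj : y j < x i) (hi : x i ≤ y i) : meanMaxLoad p x ≤ meanMaxLoad p y := by
  -- Since y j < x i ≤ y i, the weight x i is a convex combination of y i and y j; the same
  -- inequalities keep the subtractions in `ℝ≥0` from truncating.
  obtain ⟨s, t, hst, hxi⟩ : ∃ s t : ℝ≥0, s + t = 1 ∧ x i = s * y i + t * y j := by
    have hpos : (0 : ℝ) < y i - y j := sub_pos.2 (by exact_mod_cast hj.trans_le hi)
    refine ⟨(x i - y j) / (y i - y j), (y i - x i) / (y i - y j), ?_, ?_⟩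
    all_goals
      rw [← NNReal.coe_inj]
      push_cast [NNReal.coe_sub hj.le, NNReal.coe_sub hi, NNReal.coe_sub (hj.le.trans hi)]
      field_simp
      ring
  have hxj : x j = s * y j + t * y i := by
    have hst' : (s : ℝ) + t = 1 := by exact_mod_cast hst
    have hxi' : (x i : ℝ) = s * y i + t * y j := by exact_mod_cast hxi
    have hsum' : (y i : ℝ) + y j = x i + x j := by exact_mod_cast hsum
    ext
    push_cast
    linear_combination (-1 : ℝ) * hsum' - hxi' - (y i + y j : ℝ) * hst'
  -- Swapping two balls does not change the mean, and x is the convex combination of y and its swap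
  -- z; convexity finishes.
  let z : ι → ℝ≥0 := y ∘ Equiv.swap i j
  have hz : meanMaxLoad p z = meanMaxLoad p y :=
    meanMaxLoad_comp_embedding hp (Equiv.swap i j).toEmbedding y
      fun k hk => (hk ⟨Equiv.swap i j k, by simp⟩).elim
  have hx : x = fun k => s * y k + t * z k := by
    funext k
    rcases eq_or_ne k i with rfl | hki
    · simpa [z] using hxi
    rcases eq_or_ne k j with rfl | hkj
    · simpa [z] using hxj
    · simp only [z, Function.comp_apply, Equiv.swap_apply_of_ne_of_ne hki hkj, ← add_mul, hst,
        one_mul, hxy k hki hkj]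
  calc meanMaxLoad p x
      ≤ meanMaxLoad p (fun k => s * y k) + meanMaxLoad p (fun k => t * z k) := by
        rw [hx]; exact meanMaxLoad_add_le _ _
    _ = (s + t : ℝ) * meanMaxLoad p y := by
        rw [meanMaxLoad_const_mul, meanMaxLoad_const_mul, hz]; ring
    _ = meanMaxLoad p y := by rw [show (s + t : ℝ) = 1 by exact_mod_cast hst, one_mul]

/-- Among the weights in `[0, 1]` of total at most `N`, unit weights for `N` balls maximize the
expected maximum weight of a bin. -/
theorem meanMaxLoad_le_of_le_one (hp : 0 < p) {N : ℕ} (x : ι → ℝ≥0) (hx : ∀ i, x i ≤ 1)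
    (hN : ∑ i, x i ≤ N) : meanMaxLoad p x ≤ meanMaxLoad p (1 : Fin N → ℝ≥0) := by
  -- Induction on the number of fractional weights.
  induction hn : #{i | 0 < x i ∧ x i < 1} using Nat.strong_induction_on generalizing x with
  | _ n ih =>
  by_cases hfrac : ∃ i j, i ≠ j ∧ (0 < x i ∧ x i < 1) ∧ (0 < x j ∧ x j < 1)
  · obtain ⟨i, j, hij, ⟨hi0, hi1⟩, hj0, hj1⟩ := hfrac
    set s := x i + x j with hs
    -- As much weight as the bound 1 allows moves from j to i. If s ≤ 1, ball j gets weight 0,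
    -- otherwise ball i gets weight 1; either way one fractional weight disappears.
    let y : ι → ℝ≥0 := Function.update (Function.update x i (min s 1)) j (s - min s 1)
    have hyj : y j = s - min s 1 := by simp [y]
    have hyi : y i = min s 1 := by simp [y, hij]
    have hyk : ∀ k, k ≠ i → k ≠ j → y k = x k := fun k hki hkj => by simp [y, hki, hkj]
    have hsum : y i + y j = x i + x j := by
      rw [hyi, hyj, add_tsub_cancel_of_le (min_le_left _ _)]
    have hyj1 : y j < x i := by
      rw [hyj, tsub_lt_iff_left (min_le_left _ _)]
      rcases min_cases s 1 with ⟨h, _⟩ | ⟨h, _⟩ <;> rw [h]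
      · exact lt_add_of_pos_right _ hi0
      · rw [hs, add_comm]; gcongr
    have hyi1 : x i ≤ y i := by
      rw [hyi]; exact le_min (le_add_of_nonneg_right zero_le) hi1.le
    refine (meanMaxLoad_le_of_transfer hp hij hyk hsum hyj1 hyi1).trans
      (ih _ ?_ y (fun k => ?_) ?_ rfl)
    · rw [← hn]
      apply card_lt_card
      rw [ssubset_iff_of_subset]
      · by_cases h1 : s ≤ 1
        · exact ⟨j, by simp [hj0, hj1], by simp [hyj, h1]⟩
        · exact ⟨i, by simp [hi0, hi1], by simp [hyi, (not_le.1 h1).le]⟩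
      · intro k
        simp only [mem_filter, mem_univ, true_and]
        rcases eq_or_ne k i with rfl | hki
        · exact fun _ => ⟨hi0, hi1⟩
        rcases eq_or_ne k j with rfl | hkj
        · exact fun _ => ⟨hj0, hj1⟩
        · rw [hyk k hki hkj]; exact id
    · rcases eq_or_ne k i with rfl | hki
      · rw [hyi]; exact min_le_right _ _
      rcases eq_or_ne k j with rfl | hkj
      · exact hyj1.le.trans hi1.le
      · rw [hyk k hki hkj]; exact hx k
    · refine le_of_eq_of_le ?_ hN
      have hsplit : ∀ u : ι → ℝ≥0, ∑ k, u k = u i + u j + ∑ k ∈ (univ.erase i).erase j, u k := by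
        intro u
        rw [← add_sum_erase univ u (mem_univ i),
          ← add_sum_erase (univ.erase i) u (mem_erase.2 ⟨hij.symm, mem_univ j⟩), add_assoc]
      rw [hsplit, hsplit x, hsum]
      congr 1
      refine sum_congr rfl fun k hk => ?_
      simp only [mem_erase, mem_univ, and_true] at hk
      exact hyk k hk.2 hk.1
  · push Not at hfrac
    let T : Finset ι := {i | x i ≠ 0}
    have hT : #T ≤ N := by
      -- All nonzero weights but at most one equal 1, and the exceptional one is positive, so the
      -- total exceeds #T - 1. Strictness with integrality of #T and N gives #T ≤ N.
      have hlt : (#T : ℝ≥0) < N + 1 := by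
        by_cases hone : ∃ i, 0 < x i ∧ x i < 1
        · obtain ⟨i, hi0, hi1⟩ := hone
          have hiT : i ∈ T := by simp [T, hi0.ne']
          have hones : ∀ k ∈ T.erase i, x k = 1 := fun k hk => by
            simp only [T, mem_erase, mem_filter, mem_univ, true_and] at hk
            exact (hx k).antisymm (hfrac i k hk.1.symm ⟨hi0, hi1⟩ |> fun h => h (pos_iff_ne_zero.2 hk.2))
          calc (#T : ℝ≥0) = ∑ k ∈ T.erase i, x k + 1 := by
                rw [sum_congr rfl hones, sum_const, nsmul_one, card_erase_of_mem hiT]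
                have := card_pos.2 ⟨i, hiT⟩
                exact_mod_cast (Nat.sub_add_cancel this).symm
            _ < (x i + ∑ k ∈ T.erase i, x k) + 1 := by
                gcongr; exact lt_add_of_pos_left _ hi0
            _ = ∑ k ∈ T, x k + 1 := by rw [add_sum_erase T x hiT]
            _ ≤ N + 1 := by gcongr; exact (sum_le_sum_of_subset (subset_univ T)).trans hN
        · push Not at hone
          have hones : ∀ k ∈ T, x k = 1 := fun k hk => by
            simp only [T, mem_filter, mem_univ, true_and] at hk
            exact (hx k).antisymm (hone k (pos_iff_ne_zero.2 hk))
          calc (#T : ℝ≥0) = ∑ k ∈ T, x k := by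
                rw [sum_congr rfl hones, sum_const, nsmul_one]
            _ ≤ N := (sum_le_sum_of_subset (subset_univ T)).trans hN
            _ < N + 1 := lt_add_one _
      exact Nat.lt_succ_iff.1 (by exact_mod_cast hlt)
    let e : Fin #T ↪ ι := T.equivFin.symm.toEmbedding.trans (Function.Embedding.subtype _)
    have he : ∀ i ∉ Set.range e, x i = 0 := fun i hi => by
      by_contra h0
      exact hi ⟨T.equivFin ⟨i, by simp [T, h0]⟩, by simp [e]⟩
    calc meanMaxLoad p x = meanMaxLoad p (x ∘ e) := (meanMaxLoad_comp_embedding hp e x he).symm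
      _ ≤ meanMaxLoad p ((1 : Fin N → ℝ≥0) ∘ Fin.castLEEmb hT) :=
        meanMaxLoad_mono fun k => hx (e k)
      _ ≤ meanMaxLoad p (1 : Fin N → ℝ≥0) := meanMaxLoad_comp_embedding_le hp _ _

/-- Balls of weight at most `B` and total weight at most `T` have a maximum load that is in
expectation at most that of `⌈T / B⌉` balls of weight `B`. -/
theorem meanMaxLoad_le (hp : 0 < p) (x : ι → ℝ≥0) {B T : ℝ≥0} (hB : ∀ i, x i ≤ B)
    (hT : ∑ i, x i ≤ T) : meanMaxLoad p x ≤ B * expMaxOccupancy (T / B) p := by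
  -- For B = 0 all weights vanish, and division by zero gives 0, so the scaling identity still
  -- holds.
  have hx : x = fun i => B * (x i / B) := by
    funext i
    rcases eq_or_ne B 0 with rfl | hB0
    · simpa using hB i
    · rw [mul_div_cancel₀ _ hB0]
  rw [hx, meanMaxLoad_const_mul, expMaxOccupancy_eq_meanMaxLoad]
  gcongr
  refine meanMaxLoad_le_of_le_one hp _ (fun i => div_le_one_of_le₀ (hB i) zero_le) ?_
  rw [← sum_div]
  exact (div_le_div_of_nonneg_right hT zero_le).trans (Nat.le_ceil _)

/-- The exponential of a load is a product over the balls, so the sum over placements factors. Each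
ball contributes e for bin j and 1 for each of the other p - 1 bins. -/
theorem sum_exp_load_one (N : ℕ) (j : Fin p) :
    ∑ f : Fin N → Fin p, Real.exp (load (1 : Fin N → ℝ) f j) = (p - 1 + Real.exp 1) ^ N := by
  have hbin : ∑ l : Fin p, Real.exp (if l = j then 1 else 0) = p - 1 + Real.exp 1 := by
    rw [← add_sum_erase univ _ (mem_univ j), sum_congr rfl (g := fun _ => (1 : ℝ))]
    · have hp : 1 ≤ p := j.pos
      simp [card_erase_of_mem, Nat.cast_sub hp]
      ring
    · intro l hl
      simp [(mem_erase.1 hl).1]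
  calc ∑ f : Fin N → Fin p, Real.exp (load (1 : Fin N → ℝ) f j)
      = ∑ f : Fin N → Fin p, ∏ i, Real.exp (if f i = j then 1 else 0) := by
        simp only [load, sum_filter, Real.exp_sum, Pi.one_apply]
    _ = ∏ _i : Fin N, ∑ l : Fin p, Real.exp (if l = j then 1 else 0) := by
        rw [prod_univ_sum, Fintype.piFinset_univ]
    _ = (p - 1 + Real.exp 1) ^ N := by simp [hbin]

/-- The exponential moment bound on the expected maximum occupancy. -/
theorem expMaxOccupancy_le (hp : 0 < p) (b : ℝ≥0) :
    expMaxOccupancy b p ≤ Real.log p + 2 * ⌈b⌉₊ / p := by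
  set N := ⌈b⌉₊
  have hp' : (0 : ℝ) < p := by exact_mod_cast hp
  set a := Real.log p + 2 * N / p with ha
  -- The inequality u + 1 ≤ exp u at u = load - a, for a fullest bin, whose exponential is then
  -- bounded by the sum over all bins.
  have hpoint : ∀ f : Fin N → Fin p, (maxLoad (1 : Fin N → ℝ≥0) f : ℝ)
      ≤ (a - 1) + Real.exp (-a) * ∑ j, Real.exp (load (1 : Fin N → ℝ) f j) := by
    intro f
    obtain ⟨j, -, hj⟩ := exists_mem_eq_sup univ ⟨⟨0, hp⟩, mem_univ _⟩ (load (1 : Fin N → ℝ≥0) f)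
    have hcoe : (maxLoad (1 : Fin N → ℝ≥0) f : ℝ) = load (1 : Fin N → ℝ) f j := by
      rw [maxLoad, hj, load, load, NNReal.coe_sum]; rfl
    rw [hcoe]
    have h1 := Real.add_one_le_exp (-a + load (1 : Fin N → ℝ) f j)
    rw [Real.exp_add] at h1
    have h2 : Real.exp (load (1 : Fin N → ℝ) f j) ≤ ∑ j, Real.exp (load (1 : Fin N → ℝ) f j) :=
      single_le_sum (f := fun j => Real.exp (load (1 : Fin N → ℝ) f j))
        (fun _ _ => (Real.exp_pos _).le) (mem_univ j)
    have h3 := mul_le_mul_of_nonneg_left h2 (Real.exp_pos (-a)).le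
    linarith
  -- The moment is p·(1 + (e - 1)/p)^N ≤ p·exp(2N/p), which is exp a; this dictates the choice of
  -- `a`.
  have hmoment : average (fun f : Fin N → Fin p => ∑ j, Real.exp (load (1 : Fin N → ℝ) f j))
      ≤ Real.exp a := by
    rw [average, sum_comm]
    simp only [sum_exp_load_one, sum_const, card_univ, Fintype.card_fin, nsmul_eq_mul]
    rw [mul_div_assoc, ← div_pow, ha, Real.exp_add, Real.exp_log hp',
      show (2 * N / p : ℝ) = N * (2 / p) by ring, Real.exp_nat_mul]
    gcongr
    · have := Real.exp_pos 1
      have h1p : (1 : ℝ) ≤ p := by exact_mod_cast hp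
      exact div_nonneg (by linarith) hp'.le
    · refine le_trans ?_ (Real.add_one_le_exp _)
      rw [div_le_iff₀ hp', add_mul, div_mul_cancel₀ _ hp'.ne']
      linarith [Real.exp_one_lt_d9]
  have hconst : average (fun _ : Fin N → Fin p => a - 1) = a - 1 := by
    simp only [average, sum_const, card_univ, Fintype.card_fun, Fintype.card_fin, nsmul_eq_mul]
    push_cast
    field_simp
  rw [expMaxOccupancy_eq_meanMaxLoad]
  refine (average_mono hpoint).trans ?_
  rw [average_add, hconst, average_const_mul]
  have := mul_le_mul_of_nonneg_left hmoment (Real.exp_pos (-a)).le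
  rw [← Real.exp_add, neg_add_cancel, Real.exp_zero] at this
  linarith

/-- In log p + 2⌈T/B⌉/p, the condition B ≤ T lets the ceiling cost at most a factor 2, whence the 4;
the lower bound on T turns B log p into T/(cp). -/
theorem mul_expMaxOccupancy_le (hp : 0 < p) {c : ℝ} (hc : 0 < c) {B T : ℝ≥0} (hBT : B ≤ T)
    (hT : c * (B * p * Real.log p) ≤ T) :
    B * expMaxOccupancy (T / B) p ≤ (4 + 1 / c) * (T / p) := by
  have hp' : (0 : ℝ) < p := by exact_mod_cast hp
  rcases eq_or_ne B 0 with rfl | hB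
  · simp only [NNReal.coe_zero, zero_mul]; positivity
  have hB' : (0 : ℝ) < B := by exact_mod_cast pos_iff_ne_zero.2 hB
  have hceil : (⌈T / B⌉₊ : ℝ) ≤ 2 * (T / B) := by
    have h1 : (1 : ℝ) ≤ T / B := (one_le_div hB').2 (by exact_mod_cast hBT)
    have h2 : (⌈T / B⌉₊ : ℝ) < T / B + 1 := by
      exact_mod_cast Nat.ceil_lt_add_one (zero_le (a := T / B))
    linarith
  have hlog : B * Real.log p ≤ 1 / c * (T / p) := by
    rw [div_mul_div_comm, one_mul, le_div_iff₀ (by positivity)]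
    linarith
  calc (B : ℝ) * expMaxOccupancy (T / B) p
      ≤ B * (Real.log p + 2 * ⌈T / B⌉₊ / p) := by gcongr; exact expMaxOccupancy_le hp _
    _ ≤ B * (Real.log p + 2 * (2 * (T / B)) / p) := by gcongr
    _ = B * Real.log p + 4 * (T / p) := by field_simp; ring
    _ ≤ (4 + 1 / c) * (T / p) := by linarith

end Average

end Placement

/-! ### From independent uniform choices to averages over placements. -/

theorem integrable_comp_of_finite {Ω α : Type*} [MeasurableSpace Ω] [MeasurableSpace α] [Finite α]
    [MeasurableSingletonClass α] {P : MeasureTheory.Measure Ω}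
    [MeasureTheory.IsProbabilityMeasure P] {g : Ω → α} (hg : Measurable g) (φ : α → ℝ) :
    MeasureTheory.Integrable (fun ω => φ (g ω)) P := by
  have := MeasureTheory.Measure.isProbabilityMeasure_map (μ := P) hg.aemeasurable
  exact (MeasureTheory.Integrable.of_finite (μ := P.map g) (f := φ)).comp_measurable hg

namespace IsTrulyRandom

open MeasureTheory ProbabilityTheory

variable {Ω ι κ : Type*} [MeasurableSpace Ω] {P : Measure Ω} {p : ℕ} {X : ι → Ω → Fin p}

theorem comp_injective (hX : IsTrulyRandom P X) {e : κ → ι} (he : Function.Injective e) :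
    IsTrulyRandom P fun k => X (e k) :=
  ⟨fun k => hX.1 (e k), hX.2.1.precomp he, fun k => hX.2.2 (e k)⟩

variable [Fintype ι]

theorem integrable_comp [IsProbabilityMeasure P] (hX : IsTrulyRandom P X)
    (φ : (ι → Fin p) → ℝ) : Integrable (fun ω => φ fun i => X i ω) P :=
  integrable_comp_of_finite (measurable_pi_lambda _ hX.1) φ

/-- Independence and uniformity give every single placement the same probability, so the joint law
is uniform on the finite set of placements. -/
theorem integral_comp [DecidableEq ι] [IsProbabilityMeasure P] (hX : IsTrulyRandom P X)
    (φ : (ι → Fin p) → ℝ) : ∫ ω, φ (fun i => X i ω) ∂P = Placement.average φ := by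
  have hmeas : Measurable fun ω i => X i ω := measurable_pi_lambda _ hX.1
  have : IsProbabilityMeasure (P.map fun ω i => X i ω) :=
    Measure.isProbabilityMeasure_map hmeas.aemeasurable
  have hlaw : ∀ f, (P.map fun ω i => X i ω).real {f} = ((p : ℝ) ^ Fintype.card ι)⁻¹ := by
    intro f
    have hpre : (fun ω i => X i ω) ⁻¹' {f} = ⋂ i ∈ Finset.univ, X i ⁻¹' {f i} := by
      ext ω
      simp [funext_iff]
    rw [measureReal_def, Measure.map_apply hmeas (MeasurableSet.singleton f), hpre,
      hX.2.1.measure_inter_preimage_eq_mul Finset.univ fun i _ => MeasurableSet.singleton (f i)]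
    simp [hX.2.2, ENNReal.toReal_pow]
  rw [← integral_map hmeas.aemeasurable (f := φ)
    (measurable_of_countable φ).aestronglyMeasurable, integral_fintype (Integrable.of_finite)]
  simp only [hlaw, smul_eq_mul, ← Finset.mul_sum, Placement.average]
  rw [div_eq_inv_mul]

theorem integral_maxLoad_le [IsProbabilityMeasure P] (hp : 0 < p) (hX : IsTrulyRandom P X)
    (x : ι → ℝ≥0) {B T : ℝ≥0} (hB : ∀ i, x i ≤ B) (hT : ∑ i, x i ≤ T) :
    ∫ ω, (Placement.maxLoad x (fun i => X i ω) : ℝ) ∂P ≤ B * expMaxOccupancy (T / B) p := by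
  classical
  rw [hX.integral_comp fun f => (Placement.maxLoad x f : ℝ)]
  exact Placement.meanMaxLoad_le hp x hB hT

theorem integrable_maxLoad [IsProbabilityMeasure P] (hX : IsTrulyRandom P X) (x : ι → ℝ≥0) :
    Integrable (fun ω => (Placement.maxLoad x (fun i => X i ω) : ℝ)) P :=
  hX.integrable_comp fun f => (Placement.maxLoad x f : ℝ)

end IsTrulyRandom

/-- A multiset listed by a finite type is randomly distributed when the elements of the list are
placed by independent and uniform choices. -/
theorem isRandomlyDistributed_of_load {Ω ι α : Type*} [MeasurableSpace Ω] [Fintype ι]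
    {P : MeasureTheory.Measure Ω} {p : ℕ} {X : ι → Ω → Fin p} (hX : IsTrulyRandom P X)
    (a : ι → α) :
    IsRandomlyDistributed P (∑ i, {a i} : Multiset α)
      fun ω j => Placement.load (fun i => ({a i} : Multiset α)) (fun i => X i ω) j := by
  classical
  let e := (Fintype.equivFin ι).symm
  refine ⟨Fintype.card ι, a ∘ e, fun i => X (e i), ?_, hX.comp_injective e.injective,
    fun ω j => ?_⟩
  · rw [← Equiv.sum_comp e fun i => ({a i} : Multiset α), ← Multiset.sum_map_singleton
      (Multiset.map (a ∘ e) _), Multiset.map_map]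
    rfl
  · beta_reduce
    rw [← Placement.load_comp_equiv e, ← Multiset.sum_map_singleton (Multiset.map (a ∘ e) _),
      Multiset.map_map]
    rfl

/-- A multiset is the sum of the fibers of a function. -/
theorem Multiset.sum_filter_fiber {α β : Type*} [DecidableEq β] (g : α → β) (t : Finset β)
    (s : Multiset α) (hs : ∀ b ∈ s, g b ∈ t) : ∑ j ∈ t, s.filter (fun b => g b = j) = s := by
  induction s using Multiset.induction_on with
  | empty => simp
  | cons b s ih =>
    simp only [Multiset.filter_cons, Finset.sum_add_distrib]
    rw [ih fun c hc => hs c (Multiset.mem_cons_of_mem hc), Finset.sum_ite_eq,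
      if_pos (hs b (Multiset.mem_cons_self b s)), Multiset.singleton_add]

theorem Multiset.filter_finsetSum {α β : Type*} (q : α → Prop) [DecidablePred q] (t : Finset β)
    (f : β → Multiset α) : (∑ i ∈ t, f i).filter q = ∑ i ∈ t, (f i).filter q :=
  map_sum (⟨⟨Multiset.filter q, Multiset.filter_zero q⟩, Multiset.filter_add q⟩ :
    Multiset α →+ Multiset α) f t

theorem Finset.val_map_eq_sum {α β : Type*} (s : Finset β) (f : β → α) :
    s.val.map f = ∑ t ∈ s, {f t} := by
  rw [← Multiset.sum_map_singleton (s.val.map f), Multiset.map_map]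
  rfl

theorem List.sum_singleton_get {α : Type*} (l : List α) :
    ∑ t, {l.get t} = (l : Multiset α) := by
  rw [← Finset.val_map_eq_sum, Fin.univ_val_map, List.ofFn_get]

theorem List.coe_take_one {α : Type*} (l : List α) :
    (l.take 1 : Multiset α)
      = ∑ t : Fin l.length, if (t : ℕ) = 0 then {l.get t} else 0 := by
  cases l with
  | nil => simp
  | cons b l => simp

/-! ### Costs and output of the implementation, expressed as loads. -/

namespace MapReduce

open Placement

variable {I K V O : Type*}

section Words

variable (M : MapReduce I K V O)

theorem wordsB_sum {β : Type*} (t : Finset β) (f : β → Multiset (K × V)) :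
    M.wordsB (∑ i ∈ t, f i) = ∑ i ∈ t, M.wordsB (f i) :=
  map_sum (⟨⟨M.wordsB, by simp [wordsB]⟩, by simp [wordsB]⟩ : Multiset (K × V) →+ ℕ) f t

theorem wordsD_sum {β : Type*} (t : Finset β) (f : β → Multiset O) :
    M.wordsD (∑ i ∈ t, f i) = ∑ i ∈ t, M.wordsD (f i) :=
  map_sum (⟨⟨M.wordsD, by simp [wordsD]⟩, by simp [wordsD]⟩ : Multiset O →+ ℕ) f t

theorem pairs_sum {β : Type*} (t : Finset β) (f : β → Multiset I) :
    M.pairs (∑ i ∈ t, f i) = ∑ i ∈ t, M.pairs (f i) :=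
  map_sum (⟨⟨M.pairs, by simp [pairs]⟩, by simp [pairs, Multiset.add_bind]⟩ :
    Multiset I →+ Multiset (K × V)) f t

theorem wordsB_pairs (A : Multiset I) :
    M.wordsB (M.pairs A) = (A.map fun a => M.wordsB (M.map a)).sum := by
  simp [wordsB, pairs, Multiset.map_bind, Multiset.sum_bind]

/-- What a PE receives does not depend on where the input was stored, so the second superstep is
governed by the hash function and `r` alone. -/
theorem receivedPairs_eq {p : ℕ} {A : Multiset I} {store : Fin p → Multiset I}
    (hA : ∑ j, store j = A) (h : K → Fin p) (j : Fin p) :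
    M.receivedPairs store h j = (M.pairs A).filter fun b => h b.1 = j := by
  simp only [receivedPairs, sentPairs]
  rw [← Multiset.filter_finsetSum, ← pairs_sum, hA]

end Words

variable [DecidableEq K]

theorem keys_filter {p : ℕ} (B : Multiset (K × V)) (h : K → Fin p) (j : Fin p) :
    keys (B.filter fun b => h b.1 = j) = (keys B).filter fun k => h k = j := by
  ext k
  simp only [keys, Multiset.mem_toFinset, Multiset.mem_map, Multiset.mem_filter,
    Finset.mem_filter]
  constructor
  · rintro ⟨b, ⟨hb, hj⟩, rfl⟩
    exact ⟨⟨b, hb, rfl⟩, hj⟩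
  · rintro ⟨⟨b, hb, rfl⟩, hj⟩
    exact ⟨b, ⟨hb, hj⟩, rfl⟩

/-- All pairs with the same key meet on one PE; this makes the local calls of `reduce` exactly those
on C. -/
theorem valuesOf_filter {p : ℕ} (B : Multiset (K × V)) (h : K → Fin p) {j : Fin p} {k : K}
    (hk : h k = j) : valuesOf (B.filter fun b => h b.1 = j) k = valuesOf B k := by
  rw [valuesOf, Multiset.filter_filter]
  refine congrArg _ (Multiset.filter_congr fun b _ => ⟨And.left, ?_⟩)
  rintro rfl
  exact ⟨rfl, hk⟩

variable (M : MapReduce I K V O)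

theorem wordsC_valuesOf (B : Multiset (K × V)) (k : K) :
    M.wordsC k (valuesOf B k) = M.wordsB (B.filter fun b => b.1 = k) := by
  rw [wordsC, valuesOf, wordsB, Multiset.map_map]
  refine congrArg _ (Multiset.map_congr rfl fun b hb => ?_)
  rw [← (Multiset.mem_filter.1 hb).2]
  rfl

theorem sum_wordsC_valuesOf (B : Multiset (K × V)) :
    ∑ k ∈ keys B, M.wordsC k (valuesOf B k) = M.wordsB B := by
  simp only [wordsC_valuesOf, ← wordsB_sum]
  rw [Multiset.sum_filter_fiber Prod.fst (keys B) B fun b hb => by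
    simpa [keys] using ⟨b.2, hb⟩]

/-- The elements emitted by the call of `reduce` for the key `k` when the input is `A`. -/
def reduced (A : Multiset I) (k : K) : List O := M.reduce k (valuesOf (M.pairs A) k)

/-- The emissions of all calls of `reduce`: a key together with a position in the output of its
call. -/
abbrev Emission (A : Multiset I) : Type _ :=
  Σ k : keys (M.pairs A), Fin (M.reduced A k).length

/-- The output element of an emission. -/
def emission (A : Multiset I) (e : M.Emission A) : O := (M.reduced A e.1).get e.2

theorem sum_emission (A : Multiset I) : ∑ e, {M.emission A e} = M.output A := by
  rw [Fintype.sum_sigma, output,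
    ← Finset.sum_coe_sort _ fun k => (M.reduce k (valuesOf (M.pairs A) k) : Multiset O)]
  exact Finset.sum_congr rfl fun k _ => List.sum_singleton_get (M.reduced A k)

section BSP

variable {p : ℕ} {A : Multiset I} {store : Fin p → Multiset I}

/-- A sum over the calls of `reduce` on PE `j`, as a load of the hash function. -/
theorem sum_localKeys (hA : ∑ j, store j = A) (h : K → Fin p) {R : Type*} [AddCommMonoid R]
    (G : K → Multiset V → R) (j : Fin p) :
    ∑ k ∈ M.localKeys store h j, G k (M.localValues store h j k)
      = load (fun k : keys (M.pairs A) => G k (valuesOf (M.pairs A) k)) (fun k => h k) j := by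
  simp only [localKeys, localValues, M.receivedPairs_eq hA, keys_filter, load]
  rw [Finset.sum_congr rfl fun k hk => by rw [valuesOf_filter _ _ (Finset.mem_filter.1 hk).2],
    Finset.sum_filter, ← Finset.sum_coe_sort, ← Finset.sum_filter]

theorem wordsB_receivedPairs (hA : ∑ j, store j = A) (h : K → Fin p) (j : Fin p) :
    M.wordsB (M.receivedPairs store h j)
      = load (fun k : keys (M.pairs A) => M.wordsC k (valuesOf (M.pairs A) k))
          (fun k => h k) j := by
  rw [← sum_wordsC_valuesOf]
  exact M.sum_localKeys hA h M.wordsC j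

theorem keptOutput_eq (hA : ∑ j, store j = A) (h : K → Fin p) (l : Fin p) :
    M.keptOutput store h l
      = load (fun e : M.Emission A => if (e.2 : ℕ) = 0 then {M.emission A e} else 0)
          (fun e => h e.1) l := by
  refine (M.sum_localKeys hA h (fun k X => ((M.reduce k X).take 1 : Multiset O)) l).trans ?_
  rw [load, load, Finset.sum_filter, Finset.sum_filter, Fintype.sum_sigma]
  refine Finset.sum_congr rfl fun k _ => ?_
  split_ifs
  · exact List.coe_take_one (M.reduced A k)
  · simp

theorem sum_sentOutput (hA : ∑ j, store j = A) (h : K → Fin p) (r : K × ℕ → Fin p)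
    (l : Fin p) :
    ∑ j, M.sentOutput store h r j l
      = load (fun e : M.Emission A => if (e.2 : ℕ) = 0 then 0 else {M.emission A e})
          (fun e => r (e.1, e.2)) l := by
  refine (Finset.sum_congr rfl fun j _ => M.sum_localKeys hA h (fun k X =>
    (Finset.univ.filter fun t : Fin (M.reduce k X).length =>
      (t : ℕ) ≠ 0 ∧ r (k, t) = l).val.map (M.reduce k X).get) j).trans ?_
  rw [sum_load, load, Finset.sum_filter, Fintype.sum_sigma]
  refine Finset.sum_congr rfl fun k _ => ?_
  rw [Finset.val_map_eq_sum, Finset.sum_filter]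
  refine Finset.sum_congr rfl fun t _ => ?_
  by_cases ht : (t : ℕ) = 0 <;> by_cases hl : r (k, t) = l <;> simp [ht, hl, emission, reduced]

theorem bspOutput_eq (hA : ∑ j, store j = A) (h : K → Fin p) (r : K × ℕ → Fin p) (l : Fin p) :
    M.bspOutput store h r l
      = load (fun e : M.Emission A => ({M.emission A e} : Multiset O))
          (fun e => if (e.2 : ℕ) = 0 then h e.1 else r (e.1, e.2)) l := by
  rw [bspOutput, M.keptOutput_eq hA, M.sum_sentOutput hA]
  simp only [load, Finset.sum_filter, ← Finset.sum_add_distrib]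
  refine Finset.sum_congr rfl fun e _ => ?_
  by_cases he : (e.2 : ℕ) = 0 <;> simp [he]

/-- The words of the elements emitted for the key `k` that are sent to another PE. -/
def sentWords (A : Multiset I) (k : K) : ℕ :=
  ∑ t ∈ Finset.univ.filter fun t : Fin (M.reduced A k).length => (t : ℕ) ≠ 0,
    M.outputWords ((M.reduced A k).get t)

theorem sentWords_le (A : Multiset I) (k : K) :
    M.sentWords A k ≤ M.wordsD (M.reduced A k : Multiset O) := by
  rw [← List.sum_singleton_get (M.reduced A k), wordsD_sum]
  simp only [wordsD, Multiset.map_singleton, Multiset.sum_singleton]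
  exact Finset.sum_le_sum_of_subset (Finset.subset_univ _)

/-- Words sent follow the call, so the balls are keys placed by `h`; for the words received, in
`wordsD_sum_sentOutput`, the balls are emissions placed by `r`. -/
theorem sum_wordsD_sentOutput (hA : ∑ j, store j = A) (h : K → Fin p) (r : K × ℕ → Fin p)
    (j : Fin p) :
    ∑ l, M.wordsD (M.sentOutput store h r j l)
      = load (fun k : keys (M.pairs A) => M.sentWords A k) (fun k => h k) j := by
  simp only [sentOutput, wordsD_sum]
  rw [Finset.sum_comm]
  refine (M.sum_localKeys hA h (fun k X => ∑ l, M.wordsD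
    ((Finset.univ.filter fun t : Fin (M.reduce k X).length =>
      (t : ℕ) ≠ 0 ∧ r (k, t) = l).val.map (M.reduce k X).get)) j).trans ?_
  congr 1
  funext k
  simp only [wordsD, Multiset.map_map, ← Finset.filter_filter]
  exact Finset.sum_fiberwise _ _ _

theorem wordsD_sum_sentOutput (hA : ∑ j, store j = A) (h : K → Fin p) (r : K × ℕ → Fin p)
    (l : Fin p) :
    ∑ j, M.wordsD (M.sentOutput store h r j l)
      = load (fun e : M.Emission A => if (e.2 : ℕ) = 0 then 0 else M.outputWords (M.emission A e))
          (fun e => r (e.1, e.2)) l := by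
  rw [← wordsD_sum, M.sum_sentOutput hA, load, wordsD_sum, load]
  refine Finset.sum_congr rfl fun e _ => ?_
  split_ifs <;> simp [wordsD]

variable {n : ℕ} {a : Fin n → I} {x : Fin n → Fin p}

theorem sum_store (ha : Finset.univ.val.map a = A)
    (hx : ∀ j, store j = (Finset.univ.filter fun i => x i = j).val.map a) :
    ∑ j, store j = A := by
  simp only [hx, Finset.val_map_eq_sum, ← ha]
  exact sum_load (fun i => ({a i} : Multiset I)) x

/-- The running time of the two supersteps in terms of the places `x` of the input elements, the
hash values `y` of the occurring keys and the destinations `z` of the emissions. -/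
def loadTime (S : BSPMachine) (A : Multiset I) (a : Fin n → I) (x : Fin n → Fin p)
    (y : keys (M.pairs A) → Fin p) (z : M.Emission A → Fin p) : ℝ≥0 :=
  S.superstepTime
      (fun i => load (fun i => M.mapTime (a i)) x i
        + S.κ * (load (fun i => M.inputWords (a i)) x i
          + load (fun i => M.wordsB (M.map (a i))) x i : ℕ))
      (fun i => load (fun i => M.wordsB (M.map (a i))) x i
        + load (fun k : keys (M.pairs A) => M.wordsC k (valuesOf (M.pairs A) k)) y i)
    + S.superstepTime
      (fun j => load (fun k : keys (M.pairs A) => M.reduceTime k (valuesOf (M.pairs A) k)) y j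
        + S.κ * (load (fun k : keys (M.pairs A) => M.wordsC k (valuesOf (M.pairs A) k)) y j
          + load (fun k : keys (M.pairs A) => M.wordsD (M.reduced A k : Multiset O)) y j : ℕ))
      (fun j => load (fun k : keys (M.pairs A) => M.sentWords A k) y j
        + load (fun e : M.Emission A => if (e.2 : ℕ) = 0 then 0 else M.outputWords (M.emission A e)) z j)

theorem bspTime_eq_loadTime (ha : Finset.univ.val.map a = A)
    (hx : ∀ j, store j = (Finset.univ.filter fun i => x i = j).val.map a)
    (h : K → Fin p) (r : K × ℕ → Fin p) (S : BSPMachine) :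
    M.bspTime store h r S
      = M.loadTime S A a x (fun k => h k) (fun e => r (e.1, e.2)) := by
  have hA := sum_store ha hx
  have htime : ∀ i, ((store i).map M.mapTime).sum = load (fun i => M.mapTime (a i)) x i :=
    fun i => by rw [hx, Multiset.map_map]; rfl
  have hI : ∀ i, M.wordsI (store i) = load (fun i => M.inputWords (a i)) x i :=
    fun i => by rw [hx, wordsI, Multiset.map_map]; rfl
  have hB : ∀ i, M.wordsB (M.pairs (store i)) = load (fun i => M.wordsB (M.map (a i))) x i :=
    fun i => by rw [wordsB_pairs, hx, Multiset.map_map]; rfl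
  have hsent : ∀ i, ∑ j, M.wordsB (M.sentPairs store h i j) = M.wordsB (M.pairs (store i)) :=
    fun i => by
      rw [← wordsB_sum]
      exact congrArg _ (Multiset.sum_filter_fiber (fun b : K × V => h b.1) _ _ fun b _ =>
        Finset.mem_univ _)
  have hreceived : ∀ i, ∑ j, M.wordsB (M.sentPairs store h j i)
      = load (fun k : keys (M.pairs A) => M.wordsC k (valuesOf (M.pairs A) k))
          (fun k => h k) i := fun i => by
    rw [← wordsB_sum, ← M.wordsB_receivedPairs hA]
    rfl
  have hwork₁ : M.work₁ store S = fun i => load (fun i => M.mapTime (a i)) x i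
        + S.κ * (load (fun i => M.inputWords (a i)) x i
          + load (fun i => M.wordsB (M.map (a i))) x i : ℕ) := by
    funext i
    rw [work₁, htime, hI, hB]
  have hvolume₁ : M.volume₁ store h = fun i => load (fun i => M.wordsB (M.map (a i))) x i
        + load (fun k : keys (M.pairs A) => M.wordsC k (valuesOf (M.pairs A) k))
            (fun k => h k) i := by
    funext i
    rw [volume₁, hsent, hB, hreceived]
  have hwork₂ : M.work₂ store h S = fun j =>
      load (fun k : keys (M.pairs A) => M.reduceTime k (valuesOf (M.pairs A) k)) (fun k => h k) j
        + S.κ * (load (fun k : keys (M.pairs A) => M.wordsC k (valuesOf (M.pairs A) k))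
              (fun k => h k) j
          + load (fun k : keys (M.pairs A) => M.wordsD (M.reduced A k : Multiset O))
              (fun k => h k) j : ℕ) := by
    funext j
    rw [work₂, M.wordsB_receivedPairs hA, M.sum_localKeys hA h M.reduceTime]
    simp only [emitted]
    rw [M.sum_localKeys hA h (fun k X => M.wordsD (M.reduce k X : Multiset O))]
    rfl
  have hvolume₂ : M.volume₂ store h r = fun j =>
      load (fun k : keys (M.pairs A) => M.sentWords A k) (fun k => h k) j
        + load (fun e : M.Emission A =>
            if (e.2 : ℕ) = 0 then 0 else M.outputWords (M.emission A e))
          (fun e => r (e.1, e.2)) j := by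
    funext j
    rw [volume₂, M.sum_wordsD_sentOutput hA, M.wordsD_sum_sentOutput hA]
  rw [bspTime, loadTime, hwork₁, hvolume₁, hwork₂, hvolume₂]

end BSP
end MapReduce

/-! ### Expected time of the two supersteps. -/

theorem BSPMachine.superstepTime_le (S : BSPMachine) {p : ℕ} {work : Fin p → ℝ≥0}
    {vol : Fin p → ℕ} {W H : ℝ≥0} (hW : ∀ i, work i ≤ W) (hH : ∀ i, (vol i : ℝ≥0) ≤ H) :
    S.superstepTime work vol ≤ W + S.L + S.g * H := by
  have hvol : ((Finset.univ.sup vol : ℕ) : ℝ≥0) ≤ H :=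
    (Nat.le_floor_iff zero_le).1 (Finset.sup_le fun i _ => Nat.le_floor (hH i))
  have hwork : Finset.univ.sup work ≤ W := Finset.sup_le fun i _ => hW i
  unfold superstepTime
  gcongr

/-- The function `f` is integrable and its mean is at most `b`. -/
def HasMeanLE {Ω : Type*} [MeasurableSpace Ω] (P : MeasureTheory.Measure Ω) (f : Ω → ℝ)
    (b : ℝ) : Prop :=
  MeasureTheory.Integrable f P ∧ ∫ ω, f ω ∂P ≤ b

namespace HasMeanLE

open MeasureTheory

variable {Ω : Type*} [MeasurableSpace Ω] {P : Measure Ω} {f f' : Ω → ℝ} {b b' : ℝ}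

theorem add (hf : HasMeanLE P f b) (hf' : HasMeanLE P f' b') :
    HasMeanLE P (fun ω => f ω + f' ω) (b + b') :=
  ⟨hf.1.add hf'.1, (integral_add hf.1 hf'.1).trans_le (add_le_add hf.2 hf'.2)⟩

theorem const_mul (hf : HasMeanLE P f b) {c : ℝ} (hc : 0 ≤ c) :
    HasMeanLE P (fun ω => c * f ω) (c * b) :=
  ⟨hf.1.const_mul c, (integral_const_mul c f).trans_le (mul_le_mul_of_nonneg_left hf.2 hc)⟩

theorem of_le (hf' : HasMeanLE P f' b) (hf : Integrable f P) (hle : ∀ ω, f ω ≤ f' ω) :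
    HasMeanLE P f b :=
  ⟨hf, (integral_mono hf hf'.1 hle).trans hf'.2⟩

theorem const [IsProbabilityMeasure P] (c : ℝ) : HasMeanLE P (fun _ => c) c :=
  ⟨integrable_const c, by simp⟩

end HasMeanLE

namespace MapReduce

open Placement

variable {I K V O : Type*} [DecidableEq K] (M : MapReduce I K V O)

/-- The maximum of a sum of loads is at most the sum of their maxima. First emissions, which are not
sent, are charged as communication too, so that only weights bounded by m̂ and m in an obvious way
remain. -/
theorem loadTime_le {p n : ℕ} (S : BSPMachine) (A : Multiset I) (a : Fin n → I)
    (x : Fin n → Fin p) (y : keys (M.pairs A) → Fin p) (z : M.Emission A → Fin p) :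
    M.loadTime S A a x y z ≤
      (maxLoad (fun i => M.mapTime (a i)) x
        + S.κ * (maxLoad (fun i => (M.inputWords (a i) : ℝ≥0)) x
          + maxLoad (fun i => (M.wordsB (M.map (a i)) : ℝ≥0)) x) + S.L
        + S.g * (maxLoad (fun i => (M.wordsB (M.map (a i)) : ℝ≥0)) x
          + maxLoad (fun k : keys (M.pairs A) =>
              (M.wordsC k (valuesOf (M.pairs A) k) : ℝ≥0)) y))
      + (maxLoad (fun k : keys (M.pairs A) => M.reduceTime k (valuesOf (M.pairs A) k)) y
        + S.κ * (maxLoad (fun k : keys (M.pairs A) =>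
              (M.wordsC k (valuesOf (M.pairs A) k) : ℝ≥0)) y
          + maxLoad (fun k : keys (M.pairs A) =>
              (M.wordsD (M.reduced A k : Multiset O) : ℝ≥0)) y) + S.L
        + S.g * (maxLoad (fun k : keys (M.pairs A) =>
              (M.wordsD (M.reduced A k : Multiset O) : ℝ≥0)) y
          + maxLoad (fun e => (M.outputWords (M.emission A e) : ℝ≥0)) z)) := by
  refine add_le_add (S.superstepTime_le (fun i => ?_) fun i => ?_)
    (S.superstepTime_le (fun j => ?_) fun j => ?_)
  · push_cast
    simp only [natCast_load]
    gcongr <;> exact load_le_maxLoad _ _ _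
  · push_cast
    simp only [natCast_load]
    gcongr <;> exact load_le_maxLoad _ _ _
  · push_cast
    simp only [natCast_load]
    gcongr <;> exact load_le_maxLoad _ _ _
  · push_cast
    simp only [natCast_load]
    refine add_le_add ((load_le_maxLoad _ _ _).trans (maxLoad_mono (fun k => ?_) _))
      ((load_le_maxLoad _ _ _).trans (maxLoad_mono (fun e => ?_) _))
    · exact_mod_cast M.sentWords_le A k
    · split_ifs <;> simp

section Totals

variable (A : Multiset I)

theorem maxWork_le_totalWork : M.maxWork A ≤ M.totalWork A :=
  sup_le
    ((Multiset.sup_le.2 fun _ ht => Multiset.single_le_sum (fun _ _ => zero_le) _ ht).trans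
      le_self_add)
    ((Finset.sup_le fun _ hk => Finset.single_le_sum
      (f := fun k => M.reduceTime k (valuesOf (M.pairs A) k)) (fun _ _ => zero_le) hk).trans
      le_add_self)

theorem wordsD_output :
    M.wordsD (M.output A)
      = ∑ k ∈ keys (M.pairs A), M.wordsD (M.reduced A k : Multiset O) :=
  M.wordsD_sum _ _

theorem maxWords_le_totalWords : M.maxWords A ≤ M.totalWords A := by
  have hB := M.wordsB_pairs A
  have hD := M.wordsD_output A
  refine sup_le (Multiset.sup_le.2 fun t ht => ?_) (Finset.sup_le fun k hk => ?_)
  · obtain ⟨a, ha, rfl⟩ := Multiset.mem_map.1 ht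
    have h1 : M.inputWords a ≤ M.wordsI A :=
      Multiset.single_le_sum (fun _ _ => zero_le) _ (Multiset.mem_map_of_mem M.inputWords ha)
    have h2 : M.wordsB (M.map a) ≤ M.wordsB (M.pairs A) := by
      rw [hB]
      exact Multiset.single_le_sum (fun _ _ => zero_le) _
        (Multiset.mem_map_of_mem (fun a => M.wordsB (M.map a)) ha)
    unfold totalWords
    omega
  · have h1 := Finset.single_le_sum (f := fun k => M.wordsC k (valuesOf (M.pairs A) k))
      (fun _ _ => zero_le) hk
    have h2 := Finset.single_le_sum (f := fun k => M.wordsD (M.reduced A k : Multiset O))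
      (fun _ _ => zero_le) hk
    rw [← hD] at h2
    simp only [reduced] at h1 h2
    unfold totalWords
    omega

end Totals

section Expectation

open MeasureTheory

variable {Ω : Type*} [MeasurableSpace Ω] {P : Measure Ω} [IsProbabilityMeasure P] {p n : ℕ}

theorem hasMeanLE_maxLoad {ι : Type*} [Fintype ι] (hp : 0 < p) {X : ι → Ω → Fin p}
    (hX : IsTrulyRandom P X) {w : ι → ℝ≥0} {B T : ℝ≥0} (hB : ∀ i, w i ≤ B)
    (hT : ∑ i, w i ≤ T) :
    HasMeanLE P (fun ω => (maxLoad w (fun i => X i ω) : ℝ)) (B * expMaxOccupancy (T / B) p) :=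
  ⟨hX.integrable_maxLoad w, hX.integral_maxLoad_le hp w hB hT⟩

theorem hasMeanLE_maxLoad_natCast {ι : Type*} [Fintype ι] (hp : 0 < p) {X : ι → Ω → Fin p}
    (hX : IsTrulyRandom P X) {w : ι → ℕ} {B T : ℕ} (hB : ∀ i, w i ≤ B)
    (hT : ∑ i, w i ≤ T) :
    HasMeanLE P (fun ω => (maxLoad (fun i => (w i : ℝ≥0)) (fun i => X i ω) : ℝ))
      (B * expMaxOccupancy (T / B) p) := by
  have := hasMeanLE_maxLoad (B := B) (T := T) hp hX (w := fun i => (w i : ℝ≥0))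
    (fun i => by exact_mod_cast hB i) (by exact_mod_cast hT)
  simpa using this

/-- The constants count maximum loads over both supersteps: two of evaluation time, four of words
with factor κ, four of words with factor g. Expectations are only added, so the joint law of the
three placements plays no role. -/
theorem hasMeanLE_loadTime (hp : 0 < p) (S : BSPMachine) {A : Multiset I} {a : Fin n → I}
    (ha : Finset.univ.val.map a = A) {X : Fin n → Ω → Fin p} (hX : IsTrulyRandom P X)
    {Y : keys (M.pairs A) → Ω → Fin p} (hY : IsTrulyRandom P Y)
    {Z : M.Emission A → Ω → Fin p} (hZ : IsTrulyRandom P Z) :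
    HasMeanLE P
      (fun ω => (M.loadTime S A a (fun i => X i ω) (fun k => Y k ω) (fun e => Z e ω) : ℝ))
      (2 * (M.maxWork A * expMaxOccupancy (M.totalWork A / M.maxWork A) p) + 2 * S.L
        + 4 * (S.κ + S.g)
          * (M.maxWords A * expMaxOccupancy (M.totalWords A / M.maxWords A) p)) := by
  have hmem : ∀ i, a i ∈ A := fun i => ha ▸ Multiset.mem_map_of_mem a (Finset.mem_univ i)
  have hsum : ∀ {R : Type} [AddCommMonoid R] (f : I → R), ∑ i, f (a i) = (A.map f).sum :=
    fun f => by rw [← ha, Multiset.map_map]; rfl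
  have hcallA : ∀ i, M.inputWords (a i) ⊔ M.wordsB (M.map (a i)) ≤ M.maxWords A := fun i =>
    le_sup_of_le_left (Multiset.le_sup (Multiset.mem_map_of_mem
      (fun a => M.inputWords a ⊔ M.wordsB (M.map a)) (hmem i)))
  have hcallC : ∀ k : keys (M.pairs A), M.wordsC k (valuesOf (M.pairs A) k)
      ⊔ M.wordsD (M.reduced A k : Multiset O) ≤ M.maxWords A := fun k =>
    le_sup_of_le_right (Finset.le_sup (f := fun k => M.wordsC k (valuesOf (M.pairs A) k)
      ⊔ M.wordsD (M.reduced A k : Multiset O)) k.2)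
  have hmap := hasMeanLE_maxLoad hp hX (w := fun i => M.mapTime (a i))
    (B := M.maxWork A) (T := M.totalWork A)
    (fun i => le_sup_of_le_left (Multiset.le_sup (Multiset.mem_map_of_mem M.mapTime (hmem i))))
    ((hsum M.mapTime).trans_le le_self_add)
  have hreduce := hasMeanLE_maxLoad hp hY
    (w := fun k => M.reduceTime k (valuesOf (M.pairs A) k))
    (B := M.maxWork A) (T := M.totalWork A)
    (fun k => le_sup_of_le_right (Finset.le_sup
      (f := fun k => M.reduceTime k (valuesOf (M.pairs A) k)) k.2))
    ((Finset.sum_coe_sort _ fun k => M.reduceTime k (valuesOf (M.pairs A) k)).trans_le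
      le_add_self)
  have hI := hasMeanLE_maxLoad_natCast hp hX (w := fun i => M.inputWords (a i))
    (B := M.maxWords A) (T := M.totalWords A) (fun i => le_sup_left.trans (hcallA i)) (by
      rw [hsum M.inputWords, ← wordsI, totalWords]; omega)
  have hB := hasMeanLE_maxLoad_natCast hp hX (w := fun i => M.wordsB (M.map (a i)))
    (B := M.maxWords A) (T := M.totalWords A) (fun i => le_sup_right.trans (hcallA i)) (by
      rw [hsum fun a => M.wordsB (M.map a), ← wordsB_pairs, totalWords]; omega)
  have hC := hasMeanLE_maxLoad_natCast hp hY
    (w := fun k => M.wordsC k (valuesOf (M.pairs A) k))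
    (B := M.maxWords A) (T := M.totalWords A) (fun k => le_sup_left.trans (hcallC k)) (by
      rw [Finset.sum_coe_sort _ fun k => M.wordsC k (valuesOf (M.pairs A) k), totalWords]
      omega)
  have hD := hasMeanLE_maxLoad_natCast hp hY
    (w := fun k => M.wordsD (M.reduced A k : Multiset O))
    (B := M.maxWords A) (T := M.totalWords A) (fun k => le_sup_right.trans (hcallC k)) (by
      rw [Finset.sum_coe_sort _ fun k => M.wordsD (M.reduced A k : Multiset O),
        ← wordsD_output, totalWords]
      omega)
  have hO := hasMeanLE_maxLoad_natCast hp hZ (w := fun e => M.outputWords (M.emission A e))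
    (B := M.maxWords A) (T := M.totalWords A)
    (fun e => (Multiset.single_le_sum (fun _ _ => zero_le) _ (Multiset.mem_map_of_mem _
      (List.get_mem (M.reduced A e.1) e.2))).trans (le_sup_right.trans (hcallC e.1))) (by
      have h1 : ∑ e, M.outputWords (M.emission A e) = M.wordsD (M.output A) := by
        rw [← sum_emission, wordsD_sum]
        simp [wordsD]
      rw [h1, totalWords]
      omega)
  have hint : Integrable (fun ω =>
      (M.loadTime S A a (fun i => X i ω) (fun k => Y k ω) (fun e => Z e ω) : ℝ)) P := by
    have hmeas : Measurable fun ω =>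
        ((fun i => X i ω, fun k => Y k ω, fun e => Z e ω) :
          (Fin n → Fin p) × (keys (M.pairs A) → Fin p) × (M.Emission A → Fin p)) :=
      (measurable_pi_lambda _ hX.1).prodMk
        ((measurable_pi_lambda _ hY.1).prodMk (measurable_pi_lambda _ hZ.1))
    exact integrable_comp_of_finite hmeas
      fun q => ((M.loadTime S A a q.1 q.2.1 q.2.2 : ℝ≥0) : ℝ)
  have hL := HasMeanLE.const (P := P) (S.L : ℝ)
  have hκ := S.κ.coe_nonneg
  have hg := S.g.coe_nonneg
  have htotal := (((hmap.add ((hI.add hB).const_mul hκ)).add hL).add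
    ((hB.add hC).const_mul hg)).add (((hreduce.add ((hC.add hD).const_mul hκ)).add hL).add
    ((hD.add hO).const_mul hg))
  have hle := htotal.of_le hint fun ω => by
    simpa only [NNReal.coe_add, NNReal.coe_mul] using NNReal.coe_le_coe.2
      (M.loadTime_le S A a (fun i => X i ω) (fun k => Y k ω) (fun e => Z e ω))
  refine ⟨hint, hle.2.trans_eq ?_⟩
  ring

end Expectation

/-- A first emission is placed by the hash value of its key, any other by its own entry of `r`. Each
key has one call, so no random value is used twice and the destinations inherit independence. -/
theorem injective_emission_source (A : Multiset I) :
    Function.Injective fun e : M.Emission A =>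
      if (e.2 : ℕ) = 0 then Sum.inl (e.1 : K) else Sum.inr ((e.1 : K), (e.2 : ℕ)) := by
  rintro ⟨⟨k, hk⟩, t⟩ ⟨⟨k', hk'⟩, t'⟩ he
  by_cases ht : (t : ℕ) = 0 <;> by_cases ht' : (t' : ℕ) = 0 <;> simp [ht, ht'] at he
  · subst he
    obtain rfl : t = t' := Fin.ext (ht.trans ht'.symm)
    rfl
  · obtain ⟨rfl, hval⟩ := he
    obtain rfl : t = t' := Fin.ext hval
    rfl

end MapReduce

theorem theorem2 (κ g₀ : ℝ≥0) (hg₀ : 0 < g₀) :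
    ∃ C₁ : ℝ, ∀ c : ℝ, 0 < c → ∃ C₂ : ℝ,
      ∀ {I K V O Ω : Type*} [DecidableEq K] [MeasurableSpace Ω]
        (P : MeasureTheory.Measure Ω) [MeasureTheory.IsProbabilityMeasure P]
        (p : ℕ) (_hp : 0 < p) (S : BSPMachine) (_hκ : S.κ = κ) (_hg : g₀ ≤ S.g)
        (M : MapReduce I K V O) (A : Multiset I)
        (store : Ω → Fin p → Multiset I) (_hstore : IsRandomlyDistributed P A store)
        (h : K → Ω → Fin p) (r : K × ℕ → Ω → Fin p)
        (_hr : IsTrulyRandom P (Sum.elim h r)),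
        MeasureTheory.Integrable
          (fun ω => (M.bspTime (store ω) (fun k => h k ω) (fun s => r s ω) S : ℝ)) P ∧
        ∫ ω, (M.bspTime (store ω) (fun k => h k ω) (fun s => r s ω) S : ℝ) ∂P
          ≤ C₁ * (M.maxWork A * expMaxOccupancy (M.totalWork A / M.maxWork A) p + S.L
              + S.g * M.maxWords A * expMaxOccupancy (M.totalWords A / M.maxWords A) p) ∧
        (c * (M.maxWork A * p * Real.log p) ≤ M.totalWork A →
          c * (M.maxWords A * p * Real.log p) ≤ M.totalWords A →
          ∫ ω, (M.bspTime (store ω) (fun k => h k ω) (fun s => r s ω) S : ℝ) ∂P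
            ≤ C₂ * (M.totalWork A / p + S.L + S.g * (M.totalWords A / p))) ∧
        IsRandomlyDistributed P (M.output A)
          (fun ω => M.bspOutput (store ω) (fun k => h k ω) (fun s => r s ω)) := by
  -- Since κ ≤ (κ/g₀)·g, the word term 4(κ + g) is at most (4 + 4κ/g₀)·g. The second constant has
  -- the additional factor from `mul_expMaxOccupancy_le`.
  refine ⟨4 + 4 * (κ / g₀), fun c hc => ⟨(4 + 4 * (κ / g₀)) * (4 + 1 / c), ?_⟩⟩
  intro I K V O Ω _ _ P _ p hp S hκ hg M A store hstore h r hr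
  obtain ⟨n, a, X, ha, hX, hx⟩ := hstore
  have hY : IsTrulyRandom P fun k : MapReduce.keys (M.pairs A) => h k :=
    hr.comp_injective (e := fun k : MapReduce.keys (M.pairs A) => Sum.inl (k : K))
      fun k k' hkk => Subtype.ext (Sum.inl_injective hkk)
  have hZ : IsTrulyRandom P fun e : M.Emission A => r (e.1, e.2) :=
    hr.comp_injective (e := fun e : M.Emission A => Sum.inr ((e.1 : K), (e.2 : ℕ))) <| by
      rintro ⟨⟨k, hk⟩, t⟩ ⟨⟨k', hk'⟩, t'⟩ he
      obtain ⟨rfl, hval⟩ := Prod.mk.inj (Sum.inr_injective he)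
      obtain rfl : t = t' := Fin.ext hval
      rfl
  have htime : ∀ ω, M.bspTime (store ω) (fun k => h k ω) (fun s => r s ω) S
      = M.loadTime S A a (fun i => X i ω) (fun k => h k ω) (fun e => r (e.1, e.2) ω) :=
    fun ω => M.bspTime_eq_loadTime ha (hx ω) (fun k => h k ω) (fun s => r s ω) S
  simp only [htime]
  obtain ⟨hint, hmean⟩ := M.hasMeanLE_loadTime hp S ha hX hY hZ
  set W := (M.maxWork A : ℝ) * expMaxOccupancy (M.totalWork A / M.maxWork A) p with hW
  set H := (M.maxWords A : ℝ) * expMaxOccupancy (M.totalWords A / M.maxWords A) p with hH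
  have hW0 : 0 ≤ W := mul_nonneg (NNReal.coe_nonneg _) (Placement.expMaxOccupancy_nonneg _ _)
  have hH0 : 0 ≤ H := mul_nonneg (Nat.cast_nonneg _) (Placement.expMaxOccupancy_nonneg _ _)
  have hL0 : (0 : ℝ) ≤ S.L := S.L.coe_nonneg
  have hratio : (0 : ℝ) ≤ κ / g₀ := by positivity
  have hκg : (S.κ : ℝ) ≤ κ / g₀ * S.g := by
    have hg' : (g₀ : ℝ) ≤ S.g := by exact_mod_cast hg
    have hg₀' : (0 : ℝ) < g₀ := by exact_mod_cast hg₀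
    rw [hκ, div_mul_eq_mul_div, le_div_iff₀ hg₀']
    exact mul_le_mul_of_nonneg_left hg' κ.coe_nonneg
  have hfirst := calc
    ∫ ω, (M.loadTime S A a (fun i => X i ω) (fun k => h k ω) (fun e => r (e.1, e.2) ω) : ℝ) ∂P
      ≤ 2 * W + 2 * S.L + 4 * (S.κ + S.g) * H := hmean
    _ ≤ 2 * W + 2 * S.L + 4 * (κ / g₀ * S.g + S.g) * H := by gcongr
    _ ≤ (4 + 4 * (κ / g₀)) * (W + S.L + S.g * H) := by
      have h1 := mul_nonneg hratio hW0
      have h2 := mul_nonneg hratio hL0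
      linarith
  refine ⟨hint, by rwa [mul_assoc (S.g : ℝ)], fun hw hm => hfirst.trans ?_, ?_⟩
  · have hWle : W ≤ (4 + 1 / c) * (M.totalWork A / p) :=
      Placement.mul_expMaxOccupancy_le hp hc (M.maxWork_le_totalWork A) hw
    have hHle : H ≤ (4 + 1 / c) * (M.totalWords A / p) := by
      have := Placement.mul_expMaxOccupancy_le hp hc (B := M.maxWords A) (T := M.totalWords A)
        (by exact_mod_cast M.maxWords_le_totalWords A) (by simpa using hm)
      simpa using this
    have hLle : (S.L : ℝ) ≤ (4 + 1 / c) * S.L :=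
      le_mul_of_one_le_left hL0 (by have := one_div_pos.2 hc; linarith)
    calc (4 + 4 * (κ / g₀ : ℝ)) * (W + S.L + S.g * H)
        ≤ (4 + 4 * (κ / g₀)) * ((4 + 1 / c) * (M.totalWork A / p) + (4 + 1 / c) * S.L
            + S.g * ((4 + 1 / c) * (M.totalWords A / p))) := by gcongr
      _ = _ := by ring
  · have hA : ∀ ω, ∑ j, store ω j = A := fun ω => MapReduce.sum_store ha (hx ω)
    have hF := hr.comp_injective (M.injective_emission_source A)
    convert isRandomlyDistributed_of_load hF (M.emission A) using 1
    · exact (M.sum_emission A).symm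
    · funext ω l
      rw [M.bspOutput_eq (hA ω)]
      congr 1
      funext e
      split_ifs <;> rfl
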